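/- Let $m,n\ge 0$ be integers and let $\mathcal L(M_m,M_n)$ be the space of all linear maps from the complex $m\times m$ matrices $M_m$ to $M_n$. For $A=\sum_{i,j}a_{ij}\otimes e_{ij}\in M_n\otimes M_m$ put $A^\tau=\sum_{i,j}a_{ji}\otimes e_{ij}$, and let $\langle A,\varphi\rangle=\operatorname{Tr}\big[\big(\sum_{i,j}\varphi(e_{ij})\otimes e_{ij}\big)A^{\mathrm t}\big]$ for $\varphi\in\mathcal L(M_m,M_n)$. Write $\mathbb T=\{A: A\ge 0,\ A^\tau\ge 0\}$; let $\mathbb V_1$ be the convex cone generated by the matrices $(y\otimes x)(y\otimes x)^*$ with $y\in\mathbb C^n$, $x\in\mathbb C^m$ (the separable matrices); let $\mathbb P_1$ be the cone of positive linear maps, $\mathbb P_{m\wedge n}$ and $\mathbb P^{m\wedge n}$ the cones of completely positive and of completely copositive maps, and $\mathbb D=\operatorname{conv}(\mathbb P_{m\wedge n},\mathbb P^{m\wedge n})$ the cone of decomposable maps. For a convex set $C$, $\operatorname{int}C$ denotes its interior relative to the affine space it generates. For subspaces $D,E$ of the space of $m\times n$ matrices let $\Phi_D$ be the set of maps $X\mapsto\sum_i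 V_i^*XV_i$ with $V_i\in D$, let $\Phi^E$ be the set of maps $X\mapsto\sum_i V_i^*X^{\mathrm t}V_i$ with $V_i\in E$, and let $\sigma(D,E)=\operatorname{conv}(\Phi_D,\Phi^E)$ and $\sigma(D,E)'=\{A\in\mathbb D^\circ:\langle A,\varphi\rangle=0\text{ for all }\varphi\in\sigma(D,E)\}$, where $\mathbb D^\circ=\{A:\langle A,\varphi\rangle\ge 0\text{ for all }\varphi\in\mathbb D\}$. The pair $(D,E)$ is an exposed decomposition pair if $\sigma(D,E)$ is a face of $\mathbb D$ with $\sigma(D,E)\cap\mathbb P_{m\wedge n}=\Phi_D$ and $\sigma(D,E)\cap\mathbb P^{m\wedge n}=\Phi^E$, and $\sigma(D,E)=\{\varphi\in\mathbb D:\langle B,\varphi\rangle=0\}$ for some $B\in\mathbb D^\circ$. Let $A$ be an edge state with positive partial transpose, that is, $A\in\mathbb T\setminus\mathbb V_1$, $\operatorname{Tr}A=1$, and $A-\varepsilon(y\otimes x)(y\otimes x)^*\notin\mathbb T$ for all $\varepsilon>0$ and all nonzero $y\in\mathbb C^n$, $x\in\mathbb C^m$. Then there is exactly one face $F$ of $\mathbb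 T$ with $A\in\operatorname{int}F$, and there is an exposed decomposition pair $(D,E)$ such that 1. $F=\sigma(D,E)'$, $\sigma(D,E)\ne\mathbb D$, and $\sigma(D,E)'\setminus\{0\}\subset\mathbb T\setminus\mathbb V_1$; 2. $\operatorname{int}\sigma(D,E)\subset\operatorname{int}\mathbb P_1$; 3. $\sigma(D,E)$ arises from an indecomposable positive linear map: $\operatorname{int}\mathbb D\neq\emptyset$, and for every $\varphi_0\in\operatorname{int}\mathbb D$ there is $\varphi\in\mathbb P_1\setminus\mathbb D$ such that, for some $0<t<1$, $t$ is the largest $s\in[0,1]$ with $(1-s)\varphi_0+s\varphi\in\mathbb D$, and $(1-t)\varphi_0+t\varphi\in\operatorname{int}\sigma(D,E)$. -/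

import Mathlib

open scoped ComplexOrder Kronecker Matrix

namespace PPTEdge

/-! ### Convex sets -/

section Convexity

variable {X : Type*} [AddCommGroup X] [Module ℝ X]

/-- `F` is a (nonempty) face of the convex set `C`: a convex subset such that whenever a point of
`F` lies in the open segment between two points of `C`, both end points belong to `F`. -/
def IsFace (C F : Set X) : Prop :=
  F.Nonempty ∧ Convex ℝ F ∧ IsExtreme ℝ C F

/-- The interior of a convex set relative to the affine space that it generates. -/
abbrev relInt [TopologicalSpace X] (C : Set X) : Set X := intrinsicInterior ℝ C

end Convexity

/-! ### Block matrices in `M_n ⊗ M_m`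

The element `∑ a_{ij} ⊗ e_{ij}` of `M_n ⊗ M_m` is the matrix indexed by `Fin n × Fin m` whose entry
at `((k, i), (l, j))` is the entry of `a_{ij}` at `(k, l)`. -/

/-- `M_n ⊗ M_m`. -/
abbrev Block (m n : ℕ) : Type := Matrix (Fin n × Fin m) (Fin n × Fin m) ℂ

/-- The space `ℒ(M_m, M_n)` of all linear maps from `M_m` into `M_n`. All of them are continuous,
and the space carries its usual finite-dimensional topology. -/
abbrev Maps (m n : ℕ) : Type := Matrix (Fin m) (Fin m) ℂ →L[ℂ] Matrix (Fin n) (Fin n) ℂ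

variable {m n : ℕ}

/-- The block transpose `(∑ a_{ij} ⊗ e_{ij})^τ = ∑ a_{ji} ⊗ e_{ij}`. -/
def blockTranspose (A : Block m n) : Block m n :=
  Matrix.of fun p q => A (p.1, q.2) (q.1, p.2)

variable (m n) in
/-- The cone `𝕋` of all positive semi-definite block matrices whose block transposes are also
positive semi-definite. -/
def coneT : Set (Block m n) :=
  {A | A.PosSemidef ∧ (blockTranspose A).PosSemidef}

/-- The product vector `y ⊗ x` in `ℂⁿ ⊗ ℂᵐ`. -/
def prodVec (y : Fin n → ℂ) (x : Fin m → ℂ) : Fin n × Fin m → ℂ :=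
  fun p => y p.1 * x p.2

/-- The rank one matrix `(y ⊗ x)(y ⊗ x)^*`. -/
noncomputable def prodProj (y : Fin n → ℂ) (x : Fin m → ℂ) : Block m n :=
  Matrix.vecMulVec (prodVec y x) (star (prodVec y x))

variable (m n) in
/-- The cone `𝕍₁` of all (not normalized) separable block matrices, generated by the matrices
`(y ⊗ x)(y ⊗ x)^*`. This set of generators is closed under multiplication by nonnegative numbers,
so that its convex hull is the cone which it generates. -/
def coneV1 : Set (Block m n) :=
  convexHull ℝ {A | ∃ (y : Fin n → ℂ) (x : Fin m → ℂ), A = prodProj y x}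

/-- `A` is an edge state with positive partial transpose: it is an entangled density matrix with
positive partial transpose from which no positive multiple of the projection onto a product vector
can be subtracted such that the difference and its partial transpose remain positive. -/
def IsEdgeState (A : Block m n) : Prop :=
  A.trace = 1 ∧ A ∈ coneT m n ∧ A ∉ coneV1 m n ∧
    ∀ (y : Fin n → ℂ) (x : Fin m → ℂ), y ≠ 0 → x ≠ 0 →
      ∀ ε : ℝ, 0 < ε → A - ε • prodProj y x ∉ coneT m n

/-! ### Cones of linear maps -/

/-- The cone `ℙ₁` of all positive linear maps. -/
def coneP1 (m n : ℕ) : Set (Maps m n) :=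
  {φ | ∀ X : Matrix (Fin m) (Fin m) ℂ, X.PosSemidef → (φ X).PosSemidef}

/-- The amplification `φ ⊗ id_k : M_m ⊗ M_k → M_n ⊗ M_k`, which applies `φ` to each of the
`k × k` blocks of its argument. -/
noncomputable def amplify (φ : Maps m n) (k : ℕ) (X : Matrix (Fin m × Fin k) (Fin m × Fin k) ℂ) :
    Matrix (Fin n × Fin k) (Fin n × Fin k) ℂ :=
  Matrix.of fun p q => φ (Matrix.of fun i j => X (i, p.2) (j, q.2)) p.1 q.1

/-- The cone of all completely positive linear maps. -/
def coneCP (m n : ℕ) : Set (Maps m n) :=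
  {φ | ∀ (k : ℕ) (X : Matrix (Fin m × Fin k) (Fin m × Fin k) ℂ),
    X.PosSemidef → (amplify φ k X).PosSemidef}

/-- The cone of all completely copositive linear maps, that is, of all maps
`X ↦ ψ (Xᵗ)` with `ψ` completely positive. -/
def coneCoCP (m n : ℕ) : Set (Maps m n) :=
  {φ | ∃ ψ ∈ coneCP m n, ∀ X : Matrix (Fin m) (Fin m) ℂ, φ X = ψ Xᵀ}

/-- The cone `𝔻` of all decomposable positive linear maps. -/
def coneD (m n : ℕ) : Set (Maps m n) :=
  convexHull ℝ (coneCP m n ∪ coneCoCP m n)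

/-- `Φ_D`: the completely positive maps `X ↦ ∑ V_i^* X V_i` with `span {V_i} ⊆ D`. -/
def faceCP (D : Submodule ℂ (Matrix (Fin m) (Fin n) ℂ)) : Set (Maps m n) :=
  {φ | φ ∈ coneCP m n ∧ ∃ (ν : ℕ) (V : Fin ν → Matrix (Fin m) (Fin n) ℂ),
    Submodule.span ℂ (Set.range V) ≤ D ∧
      ∀ X : Matrix (Fin m) (Fin m) ℂ, φ X = ∑ i, (V i)ᴴ * X * V i}

/-- `Φ^E`: the completely copositive maps `X ↦ ∑ V_i^* Xᵗ V_i` with `span {V_i} ⊆ E`. -/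
def faceCoCP (E : Submodule ℂ (Matrix (Fin m) (Fin n) ℂ)) : Set (Maps m n) :=
  {φ | φ ∈ coneCoCP m n ∧ ∃ (ν : ℕ) (V : Fin ν → Matrix (Fin m) (Fin n) ℂ),
    Submodule.span ℂ (Set.range V) ≤ E ∧
      ∀ X : Matrix (Fin m) (Fin m) ℂ, φ X = ∑ i, (V i)ᴴ * Xᵀ * V i}

/-- `σ(D, E) = conv(Φ_D, Φ^E)`. -/
def sigma (D E : Submodule ℂ (Matrix (Fin m) (Fin n) ℂ)) : Set (Maps m n) :=
  convexHull ℝ (faceCP D ∪ faceCoCP E)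

/-- `(D, E)` is a decomposition pair: `σ(D, E)` is a face of `𝔻` which meets the cones of completely
positive and of completely copositive maps in `Φ_D` and `Φ^E`, respectively. -/
def IsDecompositionPair (D E : Submodule ℂ (Matrix (Fin m) (Fin n) ℂ)) : Prop :=
  IsFace (coneD m n) (sigma D E) ∧
    sigma D E ∩ coneCP m n = faceCP D ∧ sigma D E ∩ coneCoCP m n = faceCoCP E

/-! ### Duality -/

/-- The bilinear pairing `⟨A, φ⟩ = Tr [(∑ φ(e_{ij}) ⊗ e_{ij}) Aᵗ]`. -/
noncomputable def pairing (A : Block m n) (φ : Maps m n) : ℂ :=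
  ((∑ i : Fin m, ∑ j : Fin m, φ (Matrix.single i j 1) ⊗ₖ Matrix.single i j (1 : ℂ)) * Aᵀ).trace

/-- The dual cone `C°` in `M_n ⊗ M_m` of a set `C` of linear maps. Here `0 ≤ z` for a complex
number `z` means that `z` is real and nonnegative. -/
def dualCone (C : Set (Maps m n)) : Set (Block m n) :=
  {A | ∀ φ ∈ C, 0 ≤ pairing A φ}

/-- The dual face `S' = {A ∈ C° : ⟨A, φ⟩ = 0 for all φ ∈ S}` of a subset `S` of `C`. -/
def dualFace (C S : Set (Maps m n)) : Set (Block m n) :=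
  {A | A ∈ dualCone C ∧ ∀ φ ∈ S, pairing A φ = 0}

/-- `(D, E)` is an exposed decomposition pair: the face `σ(D, E)` of `𝔻` is of the form
`{φ ∈ 𝔻 : ⟨A, φ⟩ = 0}` for some `A` in the dual cone of `𝔻`. -/
def IsExposedDecompositionPair (D E : Submodule ℂ (Matrix (Fin m) (Fin n) ℂ)) : Prop :=
  IsDecompositionPair D E ∧
    ∃ A ∈ dualCone (coneD m n), sigma D E = {φ | φ ∈ coneD m n ∧ pairing A φ = 0}

/-- The face `F` of `𝔻` arises from the map `φ` and the starting point `φ₀`: moving from `φ₀` to `φ`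
along the segment, the last point that belongs to `𝔻` comes strictly between the two end points, and
`F` is the face of `𝔻` that contains this point in its interior. -/
def ArisesFrom (F : Set (Maps m n)) (φ₀ φ : Maps m n) : Prop :=
  ∃ t : ℝ, 0 < t ∧ t < 1 ∧
    IsGreatest {s : ℝ | s ∈ Set.Icc 0 1 ∧ (1 - s) • φ₀ + s • φ ∈ coneD m n} t ∧
    IsFace (coneD m n) F ∧ (1 - t) • φ₀ + t • φ ∈ relInt F

end PPTEdge

open PPTEdge

/-!
The cone `𝕋` is the dual cone of `𝔻`: by Choi's theorem (`mem_coneCP_iff`) the completely positive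
maps are the sums of maps `X ↦ V^* X V`, the pairing of `A` with such a map is the value `v^* A v`
of the quadratic form of `A` at the vector `v` with the entries of `V` (`pairing_krausMap`), and
transposition turns `A` into its block transpose (`pairing_comp_transposeMap`, `dualCone_coneD`).

For `A ∈ 𝕋` let `D` and `E` be the kernels of `A` and `A^τ`, viewed as spaces of `m × n` matrices.
The face of `𝔻` exposed by `A` is exactly `σ(D, E)`, and its intersections with the completely
positive and the completely copositive maps are `Φ_D` and `Φ^E`
(`isExposedDecompositionPair_kerSubmodule`). The dual face `F = σ(D, E)'` consists of all `B ∈ 𝕋`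
whose kernel contains that of `A` and for which the kernel of `B^τ` contains that of `A^τ`. A
positive semidefinite matrix dominates a small multiple of every such `B`
(`exists_sub_smul_posSemidef`), so that `A - ε B ∈ 𝕋` for some `ε > 0`
(`exists_sub_smul_mem_coneT`). Hence `A` is in the relative interior of `F`, and a face is
determined by any of its relatively interior points.

If `A` is an edge state, then `F` contains no nonzero separable matrix: otherwise a multiple of a
product projection could be subtracted from `A` (`IsEdgeState.notMem_coneV1`). A map in the relative
interior of `σ(D, E)` which is annihilated by a product projection `P` would give `P ∈ F`. So the
values of such a map at rank one projections are strictly positive definite, and by compactness the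
map is in the relative interior of `ℙ₁` (`IsEdgeState.relInt_sigma_subset`). Extending the segment
from a given `φ₀` in the relative interior of `𝔻` to a relatively interior point of the proper face
`σ(D, E)` slightly beyond that point leaves `𝔻` at once, but stays in `ℙ₁`, which yields the
indecomposable map from which the face arises (`exists_arisesFrom`).
-/

namespace PPTEdge

/-! ### Relative interiors and faces of convex sets -/

section RelInt

variable {X : Type*} [AddCommGroup X] [Module ℝ X] [TopologicalSpace X]

/-- A point is relatively interior if the set is a neighbourhood of it within the affine span. This
avoids the subtype in the definition of the intrinsic interior. -/
theorem mem_relInt_iff_mem_nhdsWithin {C : Set X} {x : X} :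
    x ∈ relInt C ↔ x ∈ affineSpan ℝ C ∧ C ∈ nhdsWithin x (affineSpan ℝ C : Set X) := by
  rw [mem_intrinsicInterior]
  constructor
  · rintro ⟨y, hy, rfl⟩
    refine ⟨y.2, ?_⟩
    rw [mem_interior_iff_mem_nhds] at hy
    exact mem_nhdsWithin_iff_exists_mem_nhds_inter.2 ((mem_nhds_subtype _ _ _).1 hy |>.imp
      fun u hu => ⟨hu.1, fun w hw => hu.2 (show (⟨w, hw.2⟩ : affineSpan ℝ C) ∈ _ from hw.1)⟩)
  · rintro ⟨hx, hC⟩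
    refine ⟨⟨x, hx⟩, ?_, rfl⟩
    rw [mem_interior_iff_mem_nhds]
    exact preimage_coe_mem_nhds_subtype.2 hC

variable [IsTopologicalAddGroup X] [ContinuousSMul ℝ X]

/-- From a point of the relative interior one can move a little beyond, away from any other point
of the set. -/
theorem exists_add_smul_sub_mem_of_mem_relInt {C : Set X} {x y : X} (hx : x ∈ relInt C)
    (hy : y ∈ C) : ∃ δ : ℝ, 0 < δ ∧ x + δ • (x - y) ∈ C := by
  obtain ⟨hxS, hxC⟩ := mem_relInt_iff_mem_nhdsWithin.1 hx
  have hyS : y ∈ affineSpan ℝ C := subset_affineSpan ℝ C hy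
  have hline : Filter.Tendsto (fun s : ℝ => x + s • (x - y)) (nhds 0)
      (nhdsWithin x (affineSpan ℝ C : Set X)) := by
    refine tendsto_nhdsWithin_iff.2 ⟨?_, Filter.Eventually.of_forall fun s => ?_⟩
    · have h : Continuous fun s : ℝ => x + s • (x - y) := by fun_prop
      simpa using h.tendsto 0
    · have := AffineSubspace.smul_vsub_vadd_mem (affineSpan ℝ C) s hxS hyS hxS
      simpa [add_comm] using this
  have hev : ∀ᶠ s in nhdsWithin (0 : ℝ) (Set.Ioi 0), x + s • (x - y) ∈ C :=
    nhdsWithin_le_nhds (hline hxC)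
  obtain ⟨δ, hδ, hδ0⟩ := (hev.and self_mem_nhdsWithin).exists
  exact ⟨δ, hδ0, hδ⟩

/-- The half-open segment from a relatively interior point to a point of a convex set consists of
relatively interior points. -/
theorem combo_mem_relInt {C : Set X} (hC : Convex ℝ C) {x y : X} (hx : x ∈ relInt C) (hy : y ∈ C)
    {t : ℝ} (ht0 : 0 < t) (ht1 : t ≤ 1) : y + t • (x - y) ∈ relInt C := by
  obtain ⟨hxS, hxC⟩ := mem_relInt_iff_mem_nhdsWithin.1 hx
  have hyS : y ∈ affineSpan ℝ C := subset_affineSpan ℝ C hy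
  have hmem : ∀ (s : ℝ) {w : X}, w ∈ affineSpan ℝ C → y + s • (w - y) ∈ affineSpan ℝ C := by
    intro s w hw
    have := AffineSubspace.smul_vsub_vadd_mem (affineSpan ℝ C) s hw hyS hyS
    simpa [add_comm] using this
  refine mem_relInt_iff_mem_nhdsWithin.2 ⟨hmem t hxS, ?_⟩
  -- The dilation of ratio `1 / t` about `y` maps the new point to `x`.
  have hdil : Filter.Tendsto (fun w : X => y + t⁻¹ • (w - y))
      (nhdsWithin (y + t • (x - y)) (affineSpan ℝ C : Set X))
      (nhdsWithin x (affineSpan ℝ C : Set X)) := by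
    refine tendsto_nhdsWithin_iff.2 ⟨?_, ?_⟩
    · have h : Continuous fun w : X => y + t⁻¹ • (w - y) := by fun_prop
      have h' := (h.tendsto (y + t • (x - y))).mono_left
        (nhdsWithin_le_nhds (s := (affineSpan ℝ C : Set X)))
      simpa [smul_smul, inv_mul_cancel₀ ht0.ne'] using h'
    · filter_upwards [self_mem_nhdsWithin] with w hw using hmem _ hw
  filter_upwards [hdil hxC] with w hw
  have := hC hy hw (sub_nonneg.2 ht1) ht0.le (by ring)
  convert this using 1
  rw [smul_add, smul_smul, mul_inv_cancel₀ ht0.ne']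
  module

variable [T2Space X] [FiniteDimensional ℝ X]

theorem relInt_nonempty {C : Set X} (hC : Convex ℝ C) (hne : C.Nonempty) :
    (relInt C).Nonempty := by
  let e : X ≃L[ℝ] (Fin (Module.finrank ℝ X) → ℝ) := ContinuousLinearEquiv.ofFinrankEq (by simp)
  have h : (intrinsicInterior ℝ (e.toContinuousAffineEquiv '' C)).Nonempty :=
    Set.Nonempty.intrinsicInterior (hC.is_linear_image e.toLinearMap.isLinear) (hne.image _)
  rw [ContinuousAffineEquiv.intrinsicInterior_image] at h
  exact h.of_image

/-- A point of a convex set in a finite dimensional space lies in the relative interior as soon as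
one can move a little beyond it, away from any other point of the set. -/
theorem mem_relInt_of_forall_exists {C : Set X} (hC : Convex ℝ C) {x : X} (hx : x ∈ C)
    (h : ∀ y ∈ C, ∃ δ : ℝ, 0 < δ ∧ x + δ • (x - y) ∈ C) : x ∈ relInt C := by
  -- `x` lies between a relatively interior point and a point of `C`.
  obtain ⟨y, hy⟩ := relInt_nonempty hC ⟨x, hx⟩
  obtain ⟨δ, hδ, hz⟩ := h y (intrinsicInterior_subset hy)
  have h1 : 0 < 1 + δ := by positivity
  have := combo_mem_relInt hC hy hz (t := δ / (1 + δ)) (by positivity)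
    ((div_le_one h1).2 (by linarith))
  convert this using 1
  have : x + δ • (x - y) + (δ / (1 + δ)) • (y - (x + δ • (x - y))) =
      x + (δ - δ / (1 + δ) * (1 + δ)) • (x - y) := by module
  rw [this, div_mul_cancel₀ _ h1.ne']
  simp

end RelInt

section Faces

variable {X : Type*} [AddCommGroup X] [Module ℝ X]

theorem mem_openSegment_add_smul_sub (x y : X) {δ : ℝ} (hδ : 0 < δ) :
    x ∈ openSegment ℝ y (x + δ • (x - y)) := by
  have h1 : 0 < 1 + δ := by positivity
  refine ⟨δ / (1 + δ), 1 / (1 + δ), by positivity, by positivity, by field_simp; ring, ?_⟩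
  have : (δ / (1 + δ)) • y + (1 / (1 + δ)) • (x + δ • (x - y)) =
      ((1 + δ) / (1 + δ)) • x := by module
  rw [this, div_self h1.ne', one_smul]

variable [TopologicalSpace X] [IsTopologicalAddGroup X] [ContinuousSMul ℝ X]

/-- A face contains every subset of the convex set that has a relatively interior point in it. -/
theorem IsFace.subset_of_mem_relInt {C F G : Set X} {x : X} (hF : IsFace C F) (hxF : x ∈ F)
    (hG : G ⊆ C) (hxG : x ∈ relInt G) : G ⊆ F := by
  intro y hy
  obtain ⟨δ, hδ, hz⟩ := exists_add_smul_sub_mem_of_mem_relInt hxG hy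
  exact hF.2.2.left_mem_of_mem_openSegment (hG hy) (hG hz) hxF
    (mem_openSegment_add_smul_sub x y hδ)

/-- Two faces whose relative interiors have a common point coincide. -/
theorem IsFace.eq_of_mem_relInt {C F G : Set X} {x : X} (hF : IsFace C F) (hG : IsFace C G)
    (hxF : x ∈ relInt F) (hxG : x ∈ relInt G) : G = F :=
  (hF.subset_of_mem_relInt (intrinsicInterior_subset hxF) hG.2.2.subset hxG).antisymm
    (hG.subset_of_mem_relInt (intrinsicInterior_subset hxG) hF.2.2.subset hxF)

end Faces

/-- The convex hull of the union of two convex cones is their sum. -/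
theorem mem_convexHull_union_iff {X : Type*} [AddCommGroup X] [Module ℝ X] {P Q : Set X}
    (hP0 : (0 : X) ∈ P) (hQ0 : (0 : X) ∈ Q)
    (hPs : ∀ c : ℝ, 0 ≤ c → ∀ x ∈ P, c • x ∈ P) (hQs : ∀ c : ℝ, 0 ≤ c → ∀ x ∈ Q, c • x ∈ Q)
    (hPa : ∀ x ∈ P, ∀ y ∈ P, x + y ∈ P) (hQa : ∀ x ∈ Q, ∀ y ∈ Q, x + y ∈ Q) {z : X} :
    z ∈ convexHull ℝ (P ∪ Q) ↔ ∃ x ∈ P, ∃ y ∈ Q, x + y = z := by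
  constructor
  · refine fun hz => convexHull_min (t := {z | ∃ x ∈ P, ∃ y ∈ Q, x + y = z}) ?_ ?_ hz
    · rintro x (hx | hx)
      exacts [⟨x, hx, 0, hQ0, add_zero x⟩, ⟨0, hP0, x, hx, zero_add x⟩]
    · rintro _ ⟨x, hx, y, hy, rfl⟩ _ ⟨x', hx', y', hy', rfl⟩ a b ha hb -
      exact ⟨a • x + b • x', hPa _ (hPs a ha x hx) _ (hPs b hb x' hx'),
        a • y + b • y', hQa _ (hQs a ha y hy) _ (hQs b hb y' hy'), by module⟩
  · rintro ⟨x, hx, y, hy, rfl⟩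
    have hx' := subset_convexHull ℝ (P ∪ Q) (Or.inl (hPs 2 zero_le_two x hx))
    have hy' := subset_convexHull ℝ (P ∪ Q) (Or.inr (hQs 2 zero_le_two y hy))
    have := convex_convexHull ℝ (P ∪ Q) hx' hy' (a := 1 / 2) (b := 1 / 2) (by norm_num)
      (by norm_num) (by norm_num)
    simpa [smul_smul] using this

/-! ### Kraus decompositions -/

section Kraus

variable {m n : ℕ}

/-- An `m × n` matrix as a vector of `ℂⁿ ⊗ ℂᵐ`. -/
def vec (V : Matrix (Fin m) (Fin n) ℂ) : Fin n × Fin m → ℂ := fun p => V p.2 p.1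

/-- A linear map as the sum of its values on matrix units, entrywise. -/
theorem map_apply_eq_sum (φ : Maps m n) (X : Matrix (Fin m) (Fin m) ℂ) (k l : Fin n) :
    φ X k l = ∑ i, ∑ j, X i j * φ (Matrix.single i j 1) k l := by
  conv_lhs => rw [Matrix.matrix_eq_sum_single X]
  simp only [map_sum, Matrix.sum_apply]
  refine Finset.sum_congr rfl fun i _ => Finset.sum_congr rfl fun j _ => ?_
  have : Matrix.single i j (X i j) = X i j • Matrix.single i j (1 : ℂ) := by simp
  rw [this, map_smul, Matrix.smul_apply, smul_eq_mul]

/-- The map `X ↦ V^* X V`. -/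
noncomputable def krausMap (V : Matrix (Fin m) (Fin n) ℂ) : Maps m n :=
  LinearMap.toContinuousLinearMap
    { toFun := fun X => Vᴴ * X * V
      map_add' := fun X Y => by rw [Matrix.mul_add, Matrix.add_mul]
      map_smul' := fun c X => by simp }

@[simp]
theorem krausMap_apply (V : Matrix (Fin m) (Fin n) ℂ) (X : Matrix (Fin m) (Fin m) ℂ) :
    krausMap V X = Vᴴ * X * V := rfl

theorem conjTranspose_mul_mul_apply {α β : Type*} [Fintype α] (V : Matrix α β ℂ)
    (X : Matrix α α ℂ) (k l : β) :
    (Vᴴ * X * V) k l = ∑ i, ∑ j, X i j * (star (V i k) * V j l) := by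
  simp only [Matrix.mul_apply, Matrix.conjTranspose_apply, Finset.sum_mul]
  rw [Finset.sum_comm]
  exact Finset.sum_congr rfl fun i _ => Finset.sum_congr rfl fun j _ => by ring

theorem amplify_eq_of_kraus {φ : Maps m n} {ν : ℕ} {V : Fin ν → Matrix (Fin m) (Fin n) ℂ}
    (h : ∀ X, φ X = ∑ i, (V i)ᴴ * X * V i) (k : ℕ)
    (X : Matrix (Fin m × Fin k) (Fin m × Fin k) ℂ) :
    amplify φ k X = ∑ i, (V i ⊗ₖ (1 : Matrix (Fin k) (Fin k) ℂ))ᴴ * X *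
      (V i ⊗ₖ (1 : Matrix (Fin k) (Fin k) ℂ)) := by
  ext p q
  simp only [amplify, Matrix.of_apply, h, Matrix.sum_apply]
  refine Finset.sum_congr rfl fun r _ => ?_
  simp only [conjTranspose_mul_mul_apply]
  simp [Fintype.sum_prod_type, Matrix.one_apply, apply_ite]

/-- Choi's theorem: the completely positive maps are those with a Kraus decomposition, which is
read off from a decomposition of the Choi matrix into matrices of rank one. -/
theorem mem_coneCP_iff {φ : Maps m n} :
    φ ∈ coneCP m n ↔ ∃ (ν : ℕ) (V : Fin ν → Matrix (Fin m) (Fin n) ℂ),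
      ∀ X, φ X = ∑ i, (V i)ᴴ * X * V i := by
  constructor
  · intro hφ
    -- Amplifying `φ` at the rank one matrix of `e = ∑ eᵢ ⊗ eᵢ` gives the Choi matrix of `φ`.
    let e : Fin m × Fin m → ℂ := fun p => if p.1 = p.2 then 1 else 0
    have hpos := hφ m (Matrix.vecMulVec e (star e)) (Matrix.posSemidef_vecMulVec_self_star e)
    have hchoi : ∀ p q, amplify φ m (Matrix.vecMulVec e (star e)) p q =
        φ (Matrix.single p.2 q.2 1) p.1 q.1 := by
      intro p q
      simp only [amplify, Matrix.of_apply]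
      refine congrArg (fun Y => φ Y p.1 q.1) ?_
      ext i j
      simp only [Matrix.of_apply, Matrix.vecMulVec_apply, e, Pi.star_apply, Matrix.single_apply,
        apply_ite star, star_one, star_zero, mul_ite, mul_one, mul_zero]
      by_cases h1 : i = p.2 <;> by_cases h2 : j = q.2 <;> simp [h1, h2, eq_comm]
    obtain ⟨ν, v, hv⟩ := Matrix.posSemidef_iff_eq_sum_vecMulVec.1 hpos
    refine ⟨ν, fun r => Matrix.of fun i k => star (v r (k, i)), fun X => ?_⟩
    ext k l
    rw [map_apply_eq_sum, Matrix.sum_apply]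
    simp only [conjTranspose_mul_mul_apply]
    rw [Finset.sum_comm]
    simp_rw [Finset.sum_comm (s := (Finset.univ : Finset (Fin ν)))]
    rw [Finset.sum_comm]
    refine Finset.sum_congr rfl fun i _ => Finset.sum_congr rfl fun j _ => ?_
    rw [← hchoi (k, i) (l, j), hv, Matrix.sum_apply, Finset.mul_sum]
    simp [Matrix.vecMulVec_apply]
  · rintro ⟨ν, V, hV⟩ k X hX
    rw [amplify_eq_of_kraus hV]
    exact Matrix.posSemidef_sum _ fun i _ => hX.conjTranspose_mul_mul_same _

variable (m) in
/-- Transposition on `M_m`. -/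
noncomputable def transposeMap : Maps m m :=
  LinearMap.toContinuousLinearMap
    { toFun := fun X => Xᵀ
      map_add' := fun X Y => Matrix.transpose_add X Y
      map_smul' := fun c X => Matrix.transpose_smul c X }

@[simp]
theorem transposeMap_apply (X : Matrix (Fin m) (Fin m) ℂ) : transposeMap m X = Xᵀ := rfl

theorem eq_comp_transposeMap_iff {φ ψ : Maps m n} :
    φ = ψ.comp (transposeMap m) ↔ ∀ X, φ X = ψ Xᵀ := by
  rw [ContinuousLinearMap.ext_iff]; rfl

theorem mem_coneCoCP_iff {φ : Maps m n} :
    φ ∈ coneCoCP m n ↔ ∃ ψ ∈ coneCP m n, φ = ψ.comp (transposeMap m) := by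
  simp only [eq_comp_transposeMap_iff]; rfl

variable {D E : Submodule ℂ (Matrix (Fin m) (Fin n) ℂ)}

theorem mem_faceCP_iff {φ : Maps m n} :
    φ ∈ faceCP D ↔ ∃ (ν : ℕ) (V : Fin ν → Matrix (Fin m) (Fin n) ℂ),
      (∀ i, V i ∈ D) ∧ φ = ∑ i, krausMap (V i) := by
  have key : ∀ (ν : ℕ) (V : Fin ν → Matrix (Fin m) (Fin n) ℂ),
      φ = ∑ i, krausMap (V i) ↔ ∀ X, φ X = ∑ i, (V i)ᴴ * X * V i := by
    intro ν V
    rw [ContinuousLinearMap.ext_iff]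
    simp
  simp only [key]
  constructor
  · rintro ⟨-, ν, V, hV, h⟩
    exact ⟨ν, V, fun i => hV (Submodule.subset_span ⟨i, rfl⟩), h⟩
  · rintro ⟨ν, V, hV, h⟩
    exact ⟨mem_coneCP_iff.2 ⟨ν, V, h⟩, ν, V,
      Submodule.span_le.2 (by rintro _ ⟨i, rfl⟩; exact hV i), h⟩

theorem mem_faceCoCP_iff {φ : Maps m n} :
    φ ∈ faceCoCP E ↔ ∃ ψ ∈ faceCP E, φ = ψ.comp (transposeMap m) := by
  simp only [eq_comp_transposeMap_iff]
  constructor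
  · rintro ⟨⟨ψ, hψ, h⟩, ν, V, hV, h'⟩
    refine ⟨ψ, ⟨hψ, ν, V, hV, fun X => ?_⟩, h⟩
    have h1 := h Xᵀ
    rw [h' Xᵀ, Matrix.transpose_transpose] at h1
    exact h1.symm
  · rintro ⟨ψ, ⟨hψ, ν, V, hV, h'⟩, h⟩
    exact ⟨⟨ψ, hψ, h⟩, ν, V, hV, fun X => by rw [h, h']⟩

theorem coneCP_eq_faceCP_top : coneCP m n = faceCP ⊤ := by
  ext φ
  exact ⟨fun h => ⟨h, (mem_coneCP_iff.1 h).imp fun ν => Exists.imp fun V hV => ⟨le_top, hV⟩⟩,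
    fun h => h.1⟩

theorem coneCoCP_eq_faceCoCP_top : coneCoCP m n = faceCoCP ⊤ := by
  ext φ
  rw [mem_coneCoCP_iff, mem_faceCoCP_iff, coneCP_eq_faceCP_top]

theorem coneD_eq_sigma_top : coneD m n = sigma ⊤ ⊤ := by
  rw [coneD, sigma, coneCP_eq_faceCP_top, coneCoCP_eq_faceCoCP_top]

theorem zero_mem_faceCP : (0 : Maps m n) ∈ faceCP D :=
  mem_faceCP_iff.2 ⟨0, fun _ => 0, fun i => i.elim0, by simp⟩

theorem add_mem_faceCP {φ ψ : Maps m n} (hφ : φ ∈ faceCP D) (hψ : ψ ∈ faceCP D) :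
    φ + ψ ∈ faceCP D := by
  obtain ⟨ν, V, hV, rfl⟩ := mem_faceCP_iff.1 hφ
  obtain ⟨μ, W, hW, rfl⟩ := mem_faceCP_iff.1 hψ
  refine mem_faceCP_iff.2 ⟨ν + μ, Fin.append V W, fun i => ?_, by simp [Fin.sum_univ_add]⟩
  induction i using Fin.addCases <;> simp [hV, hW]

theorem smul_mem_faceCP {φ : Maps m n} {c : ℝ} (hc : 0 ≤ c) (hφ : φ ∈ faceCP D) :
    c • φ ∈ faceCP D := by
  obtain ⟨ν, V, hV, rfl⟩ := mem_faceCP_iff.1 hφ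
  refine mem_faceCP_iff.2 ⟨ν, fun i => ((√c : ℝ) : ℂ) • V i,
    fun i => D.smul_mem _ (hV i), ?_⟩
  rw [Finset.smul_sum]
  refine Finset.sum_congr rfl fun i _ => ?_
  ext X : 1
  simp [Matrix.conjTranspose_smul, smul_smul, Real.mul_self_sqrt hc]

theorem zero_mem_faceCoCP : (0 : Maps m n) ∈ faceCoCP E :=
  mem_faceCoCP_iff.2 ⟨0, zero_mem_faceCP, by simp⟩

theorem add_mem_faceCoCP {φ ψ : Maps m n} (hφ : φ ∈ faceCoCP E) (hψ : ψ ∈ faceCoCP E) :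
    φ + ψ ∈ faceCoCP E := by
  obtain ⟨φ', hφ', rfl⟩ := mem_faceCoCP_iff.1 hφ
  obtain ⟨ψ', hψ', rfl⟩ := mem_faceCoCP_iff.1 hψ
  exact mem_faceCoCP_iff.2 ⟨φ' + ψ', add_mem_faceCP hφ' hψ', by simp⟩

theorem smul_mem_faceCoCP {φ : Maps m n} {c : ℝ} (hc : 0 ≤ c) (hφ : φ ∈ faceCoCP E) :
    c • φ ∈ faceCoCP E := by
  obtain ⟨φ', hφ', rfl⟩ := mem_faceCoCP_iff.1 hφ
  exact mem_faceCoCP_iff.2 ⟨c • φ', smul_mem_faceCP hc hφ', by simp⟩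

theorem mem_sigma_iff {φ : Maps m n} :
    φ ∈ sigma D E ↔ ∃ φ₁ ∈ faceCP D, ∃ φ₂ ∈ faceCoCP E, φ₁ + φ₂ = φ :=
  mem_convexHull_union_iff zero_mem_faceCP zero_mem_faceCoCP
    (fun _ hc _ h => smul_mem_faceCP hc h) (fun _ hc _ h => smul_mem_faceCoCP hc h)
    (fun _ h _ h' => add_mem_faceCP h h') (fun _ h _ h' => add_mem_faceCoCP h h')

theorem mem_coneD_iff {φ : Maps m n} :
    φ ∈ coneD m n ↔ ∃ φ₁ ∈ coneCP m n, ∃ φ₂ ∈ coneCoCP m n, φ₁ + φ₂ = φ := by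
  rw [coneD_eq_sigma_top, mem_sigma_iff, coneCP_eq_faceCP_top, coneCoCP_eq_faceCoCP_top]

theorem krausMap_mem_faceCP {V : Matrix (Fin m) (Fin n) ℂ} (hV : V ∈ D) :
    krausMap V ∈ faceCP D :=
  mem_faceCP_iff.2 ⟨1, fun _ => V, fun _ => hV, by simp⟩

theorem coneCP_subset_coneP1 : coneCP m n ⊆ coneP1 m n := by
  intro φ hφ X hX
  obtain ⟨ν, V, hV⟩ := mem_coneCP_iff.1 hφ
  rw [hV]
  exact Matrix.posSemidef_sum _ fun i _ => hX.conjTranspose_mul_mul_same _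

theorem convex_coneP1 : Convex ℝ (coneP1 m n) := by
  intro φ hφ ψ hψ a b ha hb _ X hX
  exact ((hφ X hX).smul ha).add ((hψ X hX).smul hb)

theorem coneD_subset_coneP1 : coneD m n ⊆ coneP1 m n := by
  refine convexHull_min (Set.union_subset coneCP_subset_coneP1 ?_) convex_coneP1
  rintro φ ⟨ψ, hψ, h⟩ X hX
  rw [h]
  exact coneCP_subset_coneP1 hψ _ hX.transpose

end Kraus

/-! ### Positive semidefinite matrices -/

section Semidefinite

variable {ι : Type*} [Fintype ι]

/-- Over `ℂ`, nonnegativity of the quadratic form forces the matrix to be Hermitian. -/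
theorem posSemidef_of_forall_dotProduct_nonneg {A : Matrix ι ι ℂ}
    (h : ∀ v, 0 ≤ star v ⬝ᵥ A *ᵥ v) : A.PosSemidef := by
  classical
  rw [← Matrix.isPositive_toEuclideanLin_iff, LinearMap.isPositive_iff_complex]
  intro x
  have hx : inner ℂ (A.toEuclideanLin x) x = star (star x.ofLp ⬝ᵥ A *ᵥ x.ofLp) := by
    rw [EuclideanSpace.inner_eq_star_dotProduct, Matrix.ofLp_toLpLin, Matrix.toLin'_apply,
      Matrix.star_dotProduct, star_star, dotProduct_comm]
  have h0 : 0 ≤ inner ℂ (A.toEuclideanLin x) x := by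
    rw [hx]; exact star_nonneg_iff.2 (h _)
  obtain ⟨h1, h2⟩ := Complex.le_def.1 h0
  exact ⟨Complex.ext rfl (by simpa using h2), by simpa using h1⟩

/-- A matrix whose kernel contains the kernel of `S` factors through `S`. -/
theorem exists_mul_eq_of_ker_le {κ μ : Type*} [Fintype κ] [Fintype μ] (S : Matrix κ ι ℂ)
    (G : Matrix μ ι ℂ) (h : ∀ v, S *ᵥ v = 0 → G *ᵥ v = 0) :
    ∃ K : Matrix μ κ ℂ, ∀ v, G *ᵥ v = K *ᵥ (S *ᵥ v) := by
  classical
  have hker : LinearMap.ker S.mulVecLin ≤ LinearMap.ker G.mulVecLin := fun v hv => by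
    simpa using h v (by simpa using hv)
  obtain ⟨g, hg⟩ := LinearMap.exists_extend
    (((LinearMap.ker S.mulVecLin).liftQ G.mulVecLin hker).comp
      S.mulVecLin.quotKerEquivRange.symm.toLinearMap)
  refine ⟨LinearMap.toMatrix' g, fun v => ?_⟩
  have h1 := LinearMap.congr_fun hg ⟨S *ᵥ v, v, rfl⟩
  have h2 : S.mulVecLin.quotKerEquivRange.symm ⟨S *ᵥ v, v, rfl⟩ =
      (LinearMap.ker S.mulVecLin).mkQ v := S.mulVecLin.quotKerEquivRange_symm_apply_image v _
  rw [LinearMap.toMatrix'_mulVec]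
  simp only [LinearMap.comp_apply, Submodule.subtype_apply, LinearEquiv.coe_coe, h2] at h1
  simpa using h1.symm

theorem star_dotProduct_self_eq_norm_sq {κ : Type*} [Fintype κ] (w : EuclideanSpace ℂ κ) :
    star w.ofLp ⬝ᵥ w.ofLp = ((‖w‖ ^ 2 : ℝ) : ℂ) := by
  rw [dotProduct_comm, ← EuclideanSpace.inner_eq_star_dotProduct]
  simp

theorem exists_forall_dotProduct_mulVec_le {κ μ : Type*} [Fintype κ] [Fintype μ]
    (K : Matrix μ κ ℂ) : ∃ c : ℝ, 0 < c ∧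
      ∀ v, star (K *ᵥ v) ⬝ᵥ (K *ᵥ v) ≤ (c : ℂ) * (star v ⬝ᵥ v) := by
  classical
  let T := LinearMap.toContinuousLinearMap K.toEuclideanLin
  refine ⟨(‖T‖ + 1) ^ 2, by positivity, fun v => ?_⟩
  have h1 := star_dotProduct_self_eq_norm_sq (WithLp.toLp 2 v)
  have h2 := star_dotProduct_self_eq_norm_sq (T (WithLp.toLp 2 v))
  have h3 : (T (WithLp.toLp 2 v)).ofLp = K *ᵥ v := rfl
  rw [h3] at h2
  rw [h2, h1, ← Complex.ofReal_mul, ← mul_pow, Complex.real_le_real]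
  gcongr
  exact (T.le_opNorm _).trans (by gcongr; linarith)

/-- A positive semidefinite matrix dominates a small multiple of every positive semidefinite
matrix whose kernel is at least as large: writing `A = S^* S` and `B = G^* G`, the matrix `G`
factors as `G = K S`, so that `B` is bounded by `‖K‖² A`. -/
theorem exists_sub_smul_posSemidef {A B : Matrix ι ι ℂ} (hA : A.PosSemidef)
    (hB : B.PosSemidef) (h : ∀ v, A *ᵥ v = 0 → B *ᵥ v = 0) :
    ∃ ε : ℝ, 0 < ε ∧ ∀ δ : ℝ, 0 ≤ δ → δ ≤ ε → (A - δ • B).PosSemidef := by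
  classical
  open scoped MatrixOrder in
  obtain ⟨S, rfl⟩ := CStarAlgebra.nonneg_iff_eq_star_mul_self.mp hA.nonneg
  open scoped MatrixOrder in
  obtain ⟨G, rfl⟩ := CStarAlgebra.nonneg_iff_eq_star_mul_self.mp hB.nonneg
  simp only [Matrix.star_eq_conjTranspose, Matrix.conjTranspose_mul_self_mulVec_eq_zero] at h
  obtain ⟨K, hK⟩ := exists_mul_eq_of_ker_le S G h
  obtain ⟨c, hc, hcK⟩ := exists_forall_dotProduct_mulVec_le K
  have hform : ∀ (W : Matrix ι ι ℂ) v, star v ⬝ᵥ (star W * W) *ᵥ v =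
      star (W *ᵥ v) ⬝ᵥ (W *ᵥ v) := fun W v => by
    rw [Matrix.star_mulVec, ← Matrix.dotProduct_mulVec, Matrix.mulVec_mulVec,
      Matrix.star_eq_conjTranspose]
  refine ⟨c⁻¹, by positivity, fun δ hδ hδc => posSemidef_of_forall_dotProduct_nonneg fun v => ?_⟩
  have hS : 0 ≤ star (S *ᵥ v) ⬝ᵥ (S *ᵥ v) := by
    rw [← hform]; exact hA.dotProduct_mulVec_nonneg v
  rw [Matrix.sub_mulVec, dotProduct_sub, Matrix.smul_mulVec, dotProduct_smul, hform, hform, hK,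
    sub_nonneg, Complex.real_smul]
  have hδ' : (0 : ℂ) ≤ (δ : ℂ) := by exact_mod_cast hδ
  refine (mul_le_mul_of_nonneg_left (hcK (S *ᵥ v)) hδ').trans ?_
  rw [← mul_assoc, ← Complex.ofReal_mul]
  refine mul_le_of_le_one_left hS ?_
  have : δ * c ≤ 1 := by
    calc δ * c ≤ c⁻¹ * c := by gcongr
      _ = 1 := inv_mul_cancel₀ hc.ne'
  exact_mod_cast this

end Semidefinite

/-! ### Block transposition and the cone `𝕋` -/

section ConeT

variable {m n : ℕ}

theorem blockTranspose_add (A B : Block m n) :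
    blockTranspose (A + B) = blockTranspose A + blockTranspose B := rfl

theorem blockTranspose_smul (c : ℝ) (A : Block m n) :
    blockTranspose (c • A) = c • blockTranspose A := rfl

theorem add_mem_coneT {A B : Block m n} (hA : A ∈ coneT m n) (hB : B ∈ coneT m n) :
    A + B ∈ coneT m n :=
  ⟨hA.1.add hB.1, by rw [blockTranspose_add]; exact hA.2.add hB.2⟩

theorem smul_mem_coneT {A : Block m n} {c : ℝ} (hc : 0 ≤ c) (hA : A ∈ coneT m n) :
    c • A ∈ coneT m n :=
  ⟨hA.1.smul hc, by rw [blockTranspose_smul]; exact hA.2.smul hc⟩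

theorem convex_coneT : Convex ℝ (coneT m n) := fun _ hA _ hB _ _ ha hb _ =>
  add_mem_coneT (smul_mem_coneT ha hA) (smul_mem_coneT hb hB)

theorem blockTranspose_prodProj (y : Fin n → ℂ) (x : Fin m → ℂ) :
    blockTranspose (prodProj y x) = prodProj y (star x) := by
  ext p q
  simp only [blockTranspose, prodProj, prodVec, Matrix.of_apply, Matrix.vecMulVec_apply,
    Pi.star_apply, star_mul', star_star]
  ring

theorem prodProj_mem_coneT (y : Fin n → ℂ) (x : Fin m → ℂ) : prodProj y x ∈ coneT m n :=
  ⟨Matrix.posSemidef_vecMulVec_self_star _, by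
    rw [blockTranspose_prodProj]; exact Matrix.posSemidef_vecMulVec_self_star _⟩

theorem prodProj_ne_zero {y : Fin n → ℂ} {x : Fin m → ℂ} (hy : y ≠ 0) (hx : x ≠ 0) :
    prodProj y x ≠ 0 := by
  obtain ⟨k, hk⟩ := Function.ne_iff.1 hy
  obtain ⟨i, hi⟩ := Function.ne_iff.1 hx
  intro h
  have := congrFun (congrFun h (k, i)) (k, i)
  simp only [prodProj, prodVec, Matrix.vecMulVec_apply, Pi.star_apply, Matrix.zero_apply] at this
  simp_all

/-- From a nonzero separable matrix one can subtract a multiple of a product projection. -/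
theorem exists_sub_prodProj_mem_coneT {B : Block m n} (hB : B ∈ coneV1 m n) :
    B ∈ coneT m n ∧ (B ≠ 0 → ∃ y x, y ≠ 0 ∧ x ≠ 0 ∧ ∃ c : ℝ, 0 < c ∧
      B - c • prodProj y x ∈ coneT m n) := by
  refine convexHull_min (t := {B : Block m n | B ∈ coneT m n ∧ (B ≠ 0 → ∃ y x, y ≠ 0 ∧ x ≠ 0 ∧
    ∃ c : ℝ, 0 < c ∧ B - c • prodProj y x ∈ coneT m n)}) ?_ ?_ hB
  · rintro _ ⟨y, x, rfl⟩
    refine ⟨prodProj_mem_coneT y x, fun h => ⟨y, x, ?_, ?_, 1, one_pos, ?_⟩⟩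
    · rintro rfl
      exact h (by ext; simp [prodProj, prodVec, Matrix.vecMulVec_apply])
    · rintro rfl
      exact h (by ext; simp [prodProj, prodVec, Matrix.vecMulVec_apply])
    · simpa using smul_mem_coneT le_rfl (prodProj_mem_coneT y x)
  · have key : ∀ {B C : Block m n} {a : ℝ}, 0 ≤ a → C ∈ coneT m n → a • B ≠ 0 →
        (B ≠ 0 → ∃ y x, y ≠ 0 ∧ x ≠ 0 ∧ ∃ c : ℝ, 0 < c ∧ B - c • prodProj y x ∈ coneT m n) →
        ∃ y x, y ≠ 0 ∧ x ≠ 0 ∧ ∃ c : ℝ, 0 < c ∧ a • B + C - c • prodProj y x ∈ coneT m n := by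
      intro B C a ha hC hne h
      obtain ⟨y, x, hy, hx, c, hc, hmem⟩ := h (right_ne_zero_of_smul hne)
      have ha' : 0 < a := lt_of_le_of_ne ha (Ne.symm (left_ne_zero_of_smul hne))
      refine ⟨y, x, hy, hx, a * c, by positivity, ?_⟩
      have := add_mem_coneT (smul_mem_coneT ha hmem) hC
      convert this using 1
      module
    rintro B ⟨hB, hB'⟩ C ⟨hC, hC'⟩ a b ha hb hab
    refine ⟨convex_coneT hB hC ha hb hab, fun h => ?_⟩
    by_cases h0 : a • B = 0
    · rw [add_comm]
      exact key hb (smul_mem_coneT ha hB) (by simpa [h0] using h) hC'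
    · exact key ha (smul_mem_coneT hb hC) h0 hB'

end ConeT

/-! ### The pairing between block matrices and maps -/

section Pairing

variable {m n : ℕ}

theorem pairing_eq_sum (A : Block m n) (φ : Maps m n) :
    pairing A φ = ∑ p, ∑ q, φ (Matrix.single p.2 q.2 1) p.1 q.1 * A p q := by
  have hchoi : ∀ p q : Fin n × Fin m,
      (∑ i : Fin m, ∑ j : Fin m, φ (Matrix.single i j 1) ⊗ₖ Matrix.single i j (1 : ℂ)) p q =
        φ (Matrix.single p.2 q.2 1) p.1 q.1 := by
    intro p q
    simp [Matrix.sum_apply, Matrix.single_apply, ite_and]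
  simp only [pairing, Matrix.trace, Matrix.diag_apply, Matrix.mul_apply, Matrix.transpose_apply,
    hchoi]

theorem pairing_add_right (A : Block m n) (φ ψ : Maps m n) :
    pairing A (φ + ψ) = pairing A φ + pairing A ψ := by
  simp [pairing_eq_sum, add_mul, Finset.sum_add_distrib]

theorem pairing_smul_right (A : Block m n) (c : ℝ) (φ : Maps m n) :
    pairing A (c • φ) = c * pairing A φ := by
  simp [pairing_eq_sum, Finset.mul_sum, mul_assoc]

theorem pairing_sub_right (A : Block m n) (φ ψ : Maps m n) :
    pairing A (φ - ψ) = pairing A φ - pairing A ψ := by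
  simp [pairing_eq_sum, sub_mul]

theorem pairing_sum_right {ι : Type*} (s : Finset ι) (A : Block m n) (φ : ι → Maps m n) :
    pairing A (∑ i ∈ s, φ i) = ∑ i ∈ s, pairing A (φ i) := by
  classical
  induction s using Finset.induction_on with
  | empty => simp [pairing_eq_sum]
  | insert i s hi ih => rw [Finset.sum_insert hi, Finset.sum_insert hi, pairing_add_right, ih]

theorem pairing_add_left (A B : Block m n) (φ : Maps m n) :
    pairing (A + B) φ = pairing A φ + pairing B φ := by
  simp [pairing_eq_sum, mul_add, Finset.sum_add_distrib]

theorem pairing_smul_left (A : Block m n) (c : ℝ) (φ : Maps m n) :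
    pairing (c • A) φ = c * pairing A φ := by
  simp only [pairing_eq_sum, Matrix.smul_apply, Complex.real_smul, Finset.mul_sum]
  exact Finset.sum_congr rfl fun p _ => Finset.sum_congr rfl fun q _ => by ring

theorem pairing_krausMap (A : Block m n) (V : Matrix (Fin m) (Fin n) ℂ) :
    pairing A (krausMap V) = star (vec V) ⬝ᵥ A *ᵥ vec V := by
  simp only [pairing_eq_sum, krausMap_apply, conjTranspose_mul_mul_apply, dotProduct,
    Matrix.mulVec, Finset.mul_sum, vec, Pi.star_apply]
  refine Finset.sum_congr rfl fun p _ => Finset.sum_congr rfl fun q _ => ?_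
  simp only [Matrix.single_apply, ite_and, ite_mul, one_mul, zero_mul, Finset.sum_ite_eq,
    Finset.sum_ite_irrel, Finset.sum_const_zero, Finset.mem_univ, if_true]
  ring

/-- Transposing the argument of a map corresponds to the block transpose. -/
theorem pairing_comp_transposeMap (A : Block m n) (φ : Maps m n) :
    pairing A (φ.comp (transposeMap m)) = pairing (blockTranspose A) φ := by
  simp only [pairing_eq_sum, ContinuousLinearMap.comp_apply, transposeMap_apply,
    Matrix.transpose_single, blockTranspose, Matrix.of_apply, Fintype.sum_prod_type]
  refine Finset.sum_congr rfl fun k _ => ?_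
  simp_rw [Finset.sum_comm (s := (Finset.univ : Finset (Fin m)))
    (t := (Finset.univ : Finset (Fin n)))]
  refine Finset.sum_congr rfl fun l _ => ?_
  rw [Finset.sum_comm]

/-- Pairing with a product projection amounts to evaluating the quadratic form of the value of the
map at a rank one projection. -/
theorem pairing_prodProj (y : Fin n → ℂ) (x : Fin m → ℂ) (φ : Maps m n) :
    pairing (prodProj (star y) x) φ = star y ⬝ᵥ φ (Matrix.vecMulVec x (star x)) *ᵥ y := by
  simp only [pairing_eq_sum, dotProduct, Matrix.mulVec, map_apply_eq_sum φ (Matrix.vecMulVec _ _),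
    Fintype.sum_prod_type, Finset.mul_sum, Finset.sum_mul]
  refine Finset.sum_congr rfl fun k _ => ?_
  rw [Finset.sum_comm]
  refine Finset.sum_congr rfl fun l _ => Finset.sum_congr rfl fun i _ =>
    Finset.sum_congr rfl fun j _ => ?_
  simp only [prodProj, prodVec, Matrix.vecMulVec_apply, Pi.star_apply, star_mul', star_star]
  ring

theorem exists_vec_eq (v : Fin n × Fin m → ℂ) : ∃ V : Matrix (Fin m) (Fin n) ℂ, vec V = v :=
  ⟨Matrix.of fun i k => v (k, i), rfl⟩

theorem pairing_nonneg_of_mem_faceCP {D : Submodule ℂ (Matrix (Fin m) (Fin n) ℂ)} {A : Block m n}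
    (hA : A.PosSemidef) {φ : Maps m n} (hφ : φ ∈ faceCP D) : 0 ≤ pairing A φ := by
  obtain ⟨ν, V, -, rfl⟩ := mem_faceCP_iff.1 hφ
  rw [pairing_sum_right]
  exact Finset.sum_nonneg fun i _ => by
    rw [pairing_krausMap]; exact hA.dotProduct_mulVec_nonneg _

theorem pairing_nonneg_of_mem_faceCoCP {E : Submodule ℂ (Matrix (Fin m) (Fin n) ℂ)}
    {A : Block m n} (hA : (blockTranspose A).PosSemidef) {φ : Maps m n} (hφ : φ ∈ faceCoCP E) :
    0 ≤ pairing A φ := by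
  obtain ⟨ψ, hψ, rfl⟩ := mem_faceCoCP_iff.1 hφ
  rw [pairing_comp_transposeMap]
  exact pairing_nonneg_of_mem_faceCP hA hψ

theorem krausMap_mem_sigma {D E : Submodule ℂ (Matrix (Fin m) (Fin n) ℂ)}
    {V : Matrix (Fin m) (Fin n) ℂ} (hV : V ∈ D) : krausMap V ∈ sigma D E :=
  subset_convexHull ℝ _ (Or.inl (krausMap_mem_faceCP hV))

theorem krausMap_comp_transposeMap_mem_sigma {D E : Submodule ℂ (Matrix (Fin m) (Fin n) ℂ)}
    {V : Matrix (Fin m) (Fin n) ℂ} (hV : V ∈ E) :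
    (krausMap V).comp (transposeMap m) ∈ sigma D E :=
  subset_convexHull ℝ _ (Or.inr (mem_faceCoCP_iff.2 ⟨_, krausMap_mem_faceCP hV, rfl⟩))

/-- The cones `𝔻` and `𝕋` are dual to each other. -/
theorem dualCone_coneD : dualCone (coneD m n) = coneT m n := by
  ext A
  constructor
  · intro hA
    rw [coneD_eq_sigma_top] at hA
    refine ⟨posSemidef_of_forall_dotProduct_nonneg fun v => ?_,
      posSemidef_of_forall_dotProduct_nonneg fun v => ?_⟩ <;> obtain ⟨V, rfl⟩ := exists_vec_eq v
    · rw [← pairing_krausMap]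
      exact hA _ (krausMap_mem_sigma (Submodule.mem_top (x := V)))
    · rw [← pairing_krausMap, ← pairing_comp_transposeMap]
      exact hA _ (krausMap_comp_transposeMap_mem_sigma (Submodule.mem_top (x := V)))
  · intro hA φ hφ
    rw [coneD_eq_sigma_top] at hφ
    obtain ⟨φ₁, h₁, φ₂, h₂, rfl⟩ := mem_sigma_iff.1 hφ
    rw [pairing_add_right]
    exact add_nonneg (pairing_nonneg_of_mem_faceCP hA.1 h₁)
      (pairing_nonneg_of_mem_faceCoCP hA.2 h₂)

theorem sigma_mono {D E D' E' : Submodule ℂ (Matrix (Fin m) (Fin n) ℂ)} (hD : D ≤ D')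
    (hE : E ≤ E') : sigma D E ⊆ sigma D' E' := by
  have hCP : ∀ {P Q : Submodule ℂ (Matrix (Fin m) (Fin n) ℂ)}, P ≤ Q →
      faceCP P ⊆ faceCP Q := by
    rintro P Q h φ ⟨hφ, ν, V, hV, h'⟩
    exact ⟨hφ, ν, V, hV.trans h, h'⟩
  refine convexHull_mono (Set.union_subset_union (hCP hD) fun φ hφ => ?_)
  obtain ⟨ψ, hψ, rfl⟩ := mem_faceCoCP_iff.1 hφ
  exact mem_faceCoCP_iff.2 ⟨ψ, hCP hE hψ, rfl⟩

theorem sigma_subset_coneD {D E : Submodule ℂ (Matrix (Fin m) (Fin n) ℂ)} :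
    sigma D E ⊆ coneD m n := by
  rw [coneD_eq_sigma_top]; exact sigma_mono le_top le_top

theorem zero_mem_sigma {D E : Submodule ℂ (Matrix (Fin m) (Fin n) ℂ)} :
    (0 : Maps m n) ∈ sigma D E :=
  subset_convexHull ℝ _ (Or.inl zero_mem_faceCP)

/-- The dual face of `σ(D, E)` consists of all `B ∈ 𝕋` such that `D` is contained in the kernel
of `B` and `E` in the kernel of the block transpose of `B`. -/
theorem mem_dualFace_sigma_iff {D E : Submodule ℂ (Matrix (Fin m) (Fin n) ℂ)} {B : Block m n} :
    B ∈ dualFace (coneD m n) (sigma D E) ↔ B ∈ coneT m n ∧ (∀ V ∈ D, B *ᵥ vec V = 0) ∧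
      ∀ V ∈ E, blockTranspose B *ᵥ vec V = 0 := by
  rw [dualFace, Set.mem_ofPred_eq, dualCone_coneD]
  refine and_congr_right fun hB => ⟨fun h => ⟨fun V hV => ?_, fun V hV => ?_⟩, ?_⟩
  · rw [← hB.1.dotProduct_mulVec_zero_iff, ← pairing_krausMap]
    exact h _ (krausMap_mem_sigma hV)
  · rw [← hB.2.dotProduct_mulVec_zero_iff, ← pairing_krausMap, ← pairing_comp_transposeMap]
    exact h _ (krausMap_comp_transposeMap_mem_sigma hV)
  · rintro ⟨hD, hE⟩ φ hφ
    obtain ⟨φ₁, h₁, φ₂, h₂, rfl⟩ := mem_sigma_iff.1 hφ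
    obtain ⟨ν, V, hV, rfl⟩ := mem_faceCP_iff.1 h₁
    obtain ⟨ψ, hψ, rfl⟩ := mem_faceCoCP_iff.1 h₂
    obtain ⟨μ, W, hW, rfl⟩ := mem_faceCP_iff.1 hψ
    rw [pairing_add_right, pairing_comp_transposeMap, pairing_sum_right, pairing_sum_right]
    simp only [pairing_krausMap, hD _ (hV _), hE _ (hW _), dotProduct_zero,
      Finset.sum_const_zero, add_zero]

/-- Dual faces are faces of the dual cone. -/
theorem isFace_dualFace {C S : Set (Maps m n)} (hS : S ⊆ C) : IsFace (dualCone C) (dualFace C S) := by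
  refine ⟨⟨0, fun φ _ => ?_, fun φ _ => ?_⟩, ?_, ⟨fun A hA => hA.1, ?_⟩⟩
  · simp [pairing_eq_sum]
  · simp [pairing_eq_sum]
  · rintro A ⟨hA, hA'⟩ B ⟨hB, hB'⟩ a b ha hb -
    have ha' : (0 : ℂ) ≤ a := by exact_mod_cast ha
    have hb' : (0 : ℂ) ≤ b := by exact_mod_cast hb
    refine ⟨fun φ hφ => ?_, fun φ hφ => ?_⟩
    · rw [pairing_add_left, pairing_smul_left, pairing_smul_left]
      exact add_nonneg (mul_nonneg ha' (hA φ hφ)) (mul_nonneg hb' (hB φ hφ))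
    · rw [pairing_add_left, pairing_smul_left, pairing_smul_left, hA' φ hφ, hB' φ hφ]
      simp
  · rintro A hA B hB _ ⟨-, h0⟩ ⟨a, b, ha, hb, -, rfl⟩
    refine ⟨hA, fun φ hφ => ?_⟩
    have ha' : (0 : ℂ) < a := by exact_mod_cast ha
    have hb' : (0 : ℂ) < b := by exact_mod_cast hb
    have h := h0 φ hφ
    rw [pairing_add_left, pairing_smul_left, pairing_smul_left, add_eq_zero_iff_of_nonneg
      (mul_nonneg ha'.le (hA φ (hS hφ))) (mul_nonneg hb'.le (hB φ (hS hφ)))] at h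
    exact (mul_eq_zero.1 h.1).resolve_left ha'.ne'

/-- Exposed subsets of `𝔻` are faces. -/
theorem isFace_setOf_pairing_eq_zero {A : Block m n} (hA : A ∈ coneT m n) :
    IsFace (coneD m n) {φ | φ ∈ coneD m n ∧ pairing A φ = 0} := by
  rw [← dualCone_coneD] at hA
  refine ⟨⟨0, sigma_subset_coneD (D := ⊥) (E := ⊥) zero_mem_sigma, by simp [pairing_eq_sum]⟩,
    ?_, ⟨fun φ hφ => hφ.1, ?_⟩⟩
  · rintro φ ⟨hφ, hφ'⟩ ψ ⟨hψ, hψ'⟩ a b ha hb hab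
    refine ⟨convex_convexHull ℝ _ hφ hψ ha hb hab, ?_⟩
    rw [pairing_add_right, pairing_smul_right, pairing_smul_right, hφ', hψ']
    simp
  · rintro φ hφ ψ hψ _ ⟨-, h0⟩ ⟨a, b, ha, hb, -, rfl⟩
    refine ⟨hφ, ?_⟩
    have ha' : (0 : ℂ) < a := by exact_mod_cast ha
    have hb' : (0 : ℂ) < b := by exact_mod_cast hb
    rw [pairing_add_right, pairing_smul_right, pairing_smul_right, add_eq_zero_iff_of_nonneg
      (mul_nonneg ha'.le (hA φ hφ)) (mul_nonneg hb'.le (hA ψ hψ))] at h0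
    exact (mul_eq_zero.1 h0.1).resolve_left ha'.ne'

end Pairing

/-! ### The real vector space of linear maps -/

instance instContinuousSMulMaps (m n : ℕ) : ContinuousSMul ℝ (Maps m n) :=
  IsScalarTower.continuousSMul ℂ

instance instFiniteDimensionalMaps (m n : ℕ) : FiniteDimensional ℝ (Maps m n) :=
  Module.Finite.trans ℂ (Maps m n)

/-! ### The exposed face cut out by a block matrix -/

section Exposed

variable {m n : ℕ}

/-- The subspace of all `m × n` matrices which, viewed as vectors of `ℂⁿ ⊗ ℂᵐ`, lie in the kernel
of `A`. -/
def kerSubmodule (A : Block m n) : Submodule ℂ (Matrix (Fin m) (Fin n) ℂ) where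
  carrier := {V | A *ᵥ vec V = 0}
  add_mem' {V W} hV hW := by
    have h : vec (V + W) = vec V + vec W := rfl
    rw [Set.mem_ofPred_eq] at *
    rw [h, Matrix.mulVec_add, hV, hW, add_zero]
  zero_mem' := Matrix.mulVec_zero A
  smul_mem' c V hV := by
    have h : vec (c • V) = c • vec V := rfl
    rw [Set.mem_ofPred_eq] at *
    rw [h, Matrix.mulVec_smul, hV, smul_zero]

theorem mem_kerSubmodule {A : Block m n} {V : Matrix (Fin m) (Fin n) ℂ} :
    V ∈ kerSubmodule A ↔ A *ᵥ vec V = 0 := Iff.rfl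

theorem mem_faceCP_kerSubmodule_iff {A : Block m n} (hA : A.PosSemidef) {φ : Maps m n} :
    φ ∈ faceCP (kerSubmodule A) ↔ φ ∈ coneCP m n ∧ pairing A φ = 0 := by
  rw [coneCP_eq_faceCP_top, mem_faceCP_iff, mem_faceCP_iff]
  constructor
  · rintro ⟨ν, V, hV, rfl⟩
    refine ⟨⟨ν, V, fun _ => Submodule.mem_top, rfl⟩, ?_⟩
    rw [pairing_sum_right]
    exact Finset.sum_eq_zero fun i _ => by
      rw [pairing_krausMap, mem_kerSubmodule.1 (hV i), dotProduct_zero]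
  · rintro ⟨⟨ν, V, -, rfl⟩, h0⟩
    refine ⟨ν, V, fun i => ?_, rfl⟩
    rw [pairing_sum_right, Finset.sum_eq_zero_iff_of_nonneg fun i _ => by
      rw [pairing_krausMap]; exact hA.dotProduct_mulVec_nonneg _] at h0
    rw [mem_kerSubmodule, ← hA.dotProduct_mulVec_zero_iff, ← pairing_krausMap]
    exact h0 i (Finset.mem_univ i)

theorem mem_faceCoCP_kerSubmodule_iff {A : Block m n} (hA : (blockTranspose A).PosSemidef)
    {φ : Maps m n} : φ ∈ faceCoCP (kerSubmodule (blockTranspose A)) ↔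
      φ ∈ coneCoCP m n ∧ pairing A φ = 0 := by
  rw [mem_faceCoCP_iff, mem_coneCoCP_iff]
  constructor
  · rintro ⟨ψ, hψ, rfl⟩
    rw [mem_faceCP_kerSubmodule_iff hA] at hψ
    exact ⟨⟨ψ, hψ.1, rfl⟩, by rw [pairing_comp_transposeMap, hψ.2]⟩
  · rintro ⟨⟨ψ, hψ, rfl⟩, h0⟩
    rw [pairing_comp_transposeMap] at h0
    exact ⟨ψ, (mem_faceCP_kerSubmodule_iff hA).2 ⟨hψ, h0⟩, rfl⟩

/-- The face of `𝔻` exposed by `A ∈ 𝕋` is `σ(ker A, ker A^τ)`. -/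
theorem sigma_kerSubmodule {A : Block m n} (hA : A ∈ coneT m n) :
    sigma (kerSubmodule A) (kerSubmodule (blockTranspose A)) =
      {φ | φ ∈ coneD m n ∧ pairing A φ = 0} := by
  ext φ
  simp only [mem_sigma_iff, mem_faceCP_kerSubmodule_iff hA.1,
    mem_faceCoCP_kerSubmodule_iff hA.2, Set.mem_ofPred_eq, mem_coneD_iff]
  constructor
  · rintro ⟨φ₁, ⟨h₁, h₁'⟩, φ₂, ⟨h₂, h₂'⟩, rfl⟩
    exact ⟨⟨φ₁, h₁, φ₂, h₂, rfl⟩, by rw [pairing_add_right, h₁', h₂', add_zero]⟩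
  · rintro ⟨⟨φ₁, h₁, φ₂, h₂, rfl⟩, h0⟩
    rw [pairing_add_right, add_eq_zero_iff_of_nonneg
      (pairing_nonneg_of_mem_faceCP hA.1 (coneCP_eq_faceCP_top ▸ h₁))
      (pairing_nonneg_of_mem_faceCoCP hA.2 (coneCoCP_eq_faceCoCP_top ▸ h₂))] at h0
    exact ⟨φ₁, ⟨h₁, h0.1⟩, φ₂, ⟨h₂, h0.2⟩, rfl⟩

theorem isExposedDecompositionPair_kerSubmodule {A : Block m n} (hA : A ∈ coneT m n) :
    IsExposedDecompositionPair (kerSubmodule A) (kerSubmodule (blockTranspose A)) := by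
  refine ⟨⟨?_, ?_, ?_⟩, A, by rwa [dualCone_coneD], sigma_kerSubmodule hA⟩
  · rw [sigma_kerSubmodule hA]
    exact isFace_setOf_pairing_eq_zero hA
  · ext φ
    rw [mem_faceCP_kerSubmodule_iff hA.1, sigma_kerSubmodule hA]
    exact ⟨fun h => ⟨h.2, h.1.2⟩,
      fun h => ⟨⟨subset_convexHull ℝ _ (Or.inl h.1), h.2⟩, h.1⟩⟩
  · ext φ
    rw [mem_faceCoCP_kerSubmodule_iff hA.2, sigma_kerSubmodule hA]
    exact ⟨fun h => ⟨h.2, h.1.2⟩,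
      fun h => ⟨⟨subset_convexHull ℝ _ (Or.inr h.1), h.2⟩, h.1⟩⟩

/-- The bidual face of `A`: the face of `𝕋` dual to the face of `𝔻` exposed by `A`. -/
abbrev bidualFace (A : Block m n) : Set (Block m n) :=
  dualFace (coneD m n) (sigma (kerSubmodule A) (kerSubmodule (blockTranspose A)))

theorem self_mem_bidualFace {A : Block m n} (hA : A ∈ coneT m n) : A ∈ bidualFace A :=
  mem_dualFace_sigma_iff.2 ⟨hA, fun _ h => h, fun _ h => h⟩

theorem exists_sub_smul_mem_coneT {A B : Block m n} (hA : A ∈ coneT m n) (hB : B ∈ bidualFace A) :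
    ∃ ε : ℝ, 0 < ε ∧ A - ε • B ∈ coneT m n := by
  obtain ⟨hBT, h₁, h₂⟩ := mem_dualFace_sigma_iff.1 hB
  obtain ⟨ε₁, hε₁, H₁⟩ := exists_sub_smul_posSemidef hA.1 hBT.1 fun v hv => by
    obtain ⟨V, rfl⟩ := exists_vec_eq v
    exact h₁ V hv
  obtain ⟨ε₂, hε₂, H₂⟩ := exists_sub_smul_posSemidef hA.2 hBT.2 fun v hv => by
    obtain ⟨V, rfl⟩ := exists_vec_eq v
    exact h₂ V hv
  have hmin : 0 < min ε₁ ε₂ := lt_min hε₁ hε₂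
  exact ⟨min ε₁ ε₂, hmin, H₁ _ hmin.le (min_le_left _ _), H₂ _ hmin.le (min_le_right _ _)⟩

theorem isFace_bidualFace (A : Block m n) : IsFace (coneT m n) (bidualFace A) := by
  have := isFace_dualFace (C := coneD m n)
    (S := sigma (kerSubmodule A) (kerSubmodule (blockTranspose A))) sigma_subset_coneD
  rwa [dualCone_coneD] at this

theorem self_mem_relInt_bidualFace {A : Block m n} (hA : A ∈ coneT m n) :
    A ∈ relInt (bidualFace A) := by
  refine mem_relInt_of_forall_exists (isFace_bidualFace A).2.1 (self_mem_bidualFace hA)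
    fun B hB => ?_
  obtain ⟨ε, hε, hmem⟩ := exists_sub_smul_mem_coneT hA hB
  refine ⟨ε, hε, ?_⟩
  have hT : A + ε • (A - B) ∈ coneT m n := by
    have := add_mem_coneT hmem (smul_mem_coneT hε.le hA)
    convert this using 1
    module
  exact (isFace_bidualFace A).2.2.right_mem_of_mem_openSegment
    ((isFace_bidualFace A).2.2.subset hB) hT (self_mem_bidualFace hA)
    (mem_openSegment_add_smul_sub A B hε)

theorem sigma_kerSubmodule_ne_coneD {A : Block m n} (hA : A ∈ coneT m n) (hA0 : A ≠ 0) :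
    sigma (kerSubmodule A) (kerSubmodule (blockTranspose A)) ≠ coneD m n := by
  intro h
  refine hA0 (Matrix.ext_iff_mulVec.2 fun v => ?_)
  obtain ⟨V, rfl⟩ := exists_vec_eq v
  have hV : krausMap V ∈ coneD m n := by
    rw [coneD_eq_sigma_top]
    exact krausMap_mem_sigma Submodule.mem_top
  rw [← h, sigma_kerSubmodule hA] at hV
  rw [Matrix.zero_mulVec, ← hA.1.dotProduct_mulVec_zero_iff, ← pairing_krausMap]
  exact hV.2

theorem notMem_sigma_of_mem_relInt_coneD {D E : Submodule ℂ (Matrix (Fin m) (Fin n) ℂ)}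
    (hface : IsFace (coneD m n) (sigma D E)) (hne : sigma D E ≠ coneD m n) {φ : Maps m n}
    (hφ : φ ∈ relInt (coneD m n)) : φ ∉ sigma D E := fun h =>
  hne (sigma_subset_coneD.antisymm (hface.subset_of_mem_relInt h Set.Subset.rfl hφ))

end Exposed

/-! ### The relative interior of the cone of positive maps -/

section Positive

variable {m n : ℕ}

theorem mem_coneP1_of_forall {φ : Maps m n}
    (h : ∀ (x : Fin m → ℂ) (y : Fin n → ℂ),
      0 ≤ star y ⬝ᵥ φ (Matrix.vecMulVec x (star x)) *ᵥ y) : φ ∈ coneP1 m n := by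
  intro X hX
  obtain ⟨r, v, rfl⟩ := Matrix.posSemidef_iff_eq_sum_vecMulVec.1 hX
  rw [map_sum]
  exact Matrix.posSemidef_sum _ fun i _ => posSemidef_of_forall_dotProduct_nonneg (h (v i))

theorem dotProduct_map_nonneg {φ : Maps m n} (hφ : φ ∈ coneP1 m n) (x : Fin m → ℂ)
    (y : Fin n → ℂ) : 0 ≤ star y ⬝ᵥ φ (Matrix.vecMulVec x (star x)) *ᵥ y :=
  (hφ _ (Matrix.posSemidef_vecMulVec_self_star x)).dotProduct_mulVec_nonneg y

theorem dotProduct_map_smul_smul (φ : Maps m n) (a b : ℝ) (x : Fin m → ℂ) (y : Fin n → ℂ) :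
    star (b • y) ⬝ᵥ φ (Matrix.vecMulVec (a • x) (star (a • x))) *ᵥ (b • y) =
      ((a ^ 2 * b ^ 2 : ℝ) : ℂ) * (star y ⬝ᵥ φ (Matrix.vecMulVec x (star x)) *ᵥ y) := by
  have h1 : Matrix.vecMulVec (a • x) (star (a • x)) =
      ((a ^ 2 : ℝ) : ℂ) • Matrix.vecMulVec x (star x) := by
    ext i j
    simp [Matrix.vecMulVec_apply]
    ring
  have h2 : b • y = (b : ℂ) • y := by ext k; simp
  have h3 : star (b • y) = (b : ℂ) • star y := by ext k; simp
  rw [h1, h3, h2, map_smul, Matrix.smul_mulVec, Matrix.mulVec_smul]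
  simp only [smul_dotProduct, dotProduct_smul, smul_eq_mul]
  push_cast
  ring

/-- A positive map whose values at rank one projections are all strictly positive dominates a small
multiple of every positive map, by compactness of the unit spheres. -/
theorem exists_dotProduct_map_le {φ ψ : Maps m n} (hφ : φ ∈ coneP1 m n) (hψ : ψ ∈ coneP1 m n)
    (hpos : ∀ (x : Fin m → ℂ) (y : Fin n → ℂ), x ≠ 0 → y ≠ 0 →
      star y ⬝ᵥ φ (Matrix.vecMulVec x (star x)) *ᵥ y ≠ 0) :
    ∃ C : ℝ, 0 < C ∧ ∀ x y, star y ⬝ᵥ ψ (Matrix.vecMulVec x (star x)) *ᵥ y ≤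
      (C : ℂ) * (star y ⬝ᵥ φ (Matrix.vecMulVec x (star x)) *ᵥ y) := by
  let q : Maps m n → (Fin m → ℂ) × (Fin n → ℂ) → ℂ := fun φ p =>
    star p.2 ⬝ᵥ φ (Matrix.vecMulVec p.1 (star p.1)) *ᵥ p.2
  have hq : ∀ φ, Continuous (q φ) := fun φ => by
    have h1 : Continuous fun p : (Fin m → ℂ) × (Fin n → ℂ) =>
        φ (Matrix.vecMulVec p.1 (star p.1)) :=
      φ.continuous.comp (Continuous.matrix_vecMulVec continuous_fst continuous_fst.star)
    exact Continuous.dotProduct continuous_snd.star (h1.matrix_mulVec continuous_snd)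
  have hK : IsCompact (Metric.sphere (0 : Fin m → ℂ) 1 ×ˢ Metric.sphere (0 : Fin n → ℂ) 1) :=
    (isCompact_sphere _ _).prod (isCompact_sphere _ _)
  have hne : ∀ p ∈ Metric.sphere (0 : Fin m → ℂ) 1 ×ˢ Metric.sphere (0 : Fin n → ℂ) 1,
      q φ p ≠ 0 := by
    rintro ⟨x, y⟩ ⟨hx, hy⟩
    refine hpos x y ?_ ?_
    · rintro rfl; simp at hx
    · rintro rfl; simp at hy
  obtain ⟨C, hC⟩ := hK.exists_bound_of_continuousOn (f := fun p => q ψ p / q φ p)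
    ((hq ψ).continuousOn.div (hq φ).continuousOn hne)
  refine ⟨max C 1, by positivity, fun x y => ?_⟩
  by_cases hx : x = 0
  · subst hx; simp
  by_cases hy : y = 0
  · subst hy; simp
  have hx' : ‖x‖ ≠ 0 := norm_ne_zero_iff.2 hx
  have hy' : ‖y‖ ≠ 0 := norm_ne_zero_iff.2 hy
  have hxs : x = ‖x‖ • (‖x‖⁻¹ • x) := by rw [smul_smul, mul_inv_cancel₀ hx', one_smul]
  have hys : y = ‖y‖ • (‖y‖⁻¹ • y) := by rw [smul_smul, mul_inv_cancel₀ hy', one_smul]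
  have hmem : (‖x‖⁻¹ • x, ‖y‖⁻¹ • y) ∈
      Metric.sphere (0 : Fin m → ℂ) 1 ×ˢ Metric.sphere (0 : Fin n → ℂ) 1 := by
    simp [norm_smul, hx', hy']
  have hle : q ψ (‖x‖⁻¹ • x, ‖y‖⁻¹ • y) ≤ ((max C 1 : ℝ) : ℂ) * q φ (‖x‖⁻¹ • x, ‖y‖⁻¹ • y) := by
    have hb := hC _ hmem
    have hφ0 : 0 ≤ q φ (‖x‖⁻¹ • x, ‖y‖⁻¹ • y) := dotProduct_map_nonneg hφ _ _
    have hψ0 : 0 ≤ q ψ (‖x‖⁻¹ • x, ‖y‖⁻¹ • y) := dotProduct_map_nonneg hψ _ _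
    rw [norm_div, div_le_iff₀ (norm_pos_iff.2 (hne _ hmem))] at hb
    rw [Complex.eq_coe_norm_of_nonneg hφ0, Complex.eq_coe_norm_of_nonneg hψ0]
    have : ‖q ψ (‖x‖⁻¹ • x, ‖y‖⁻¹ • y)‖ ≤ max C 1 * ‖q φ (‖x‖⁻¹ • x, ‖y‖⁻¹ • y)‖ :=
      hb.trans (by gcongr; exact le_max_left _ _)
    exact_mod_cast this
  have hc : (0 : ℂ) ≤ ((‖x‖ ^ 2 * ‖y‖ ^ 2 : ℝ) : ℂ) := by
    exact_mod_cast (by positivity : (0 : ℝ) ≤ ‖x‖ ^ 2 * ‖y‖ ^ 2)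
  have hscale : ∀ χ : Maps m n, star y ⬝ᵥ χ (Matrix.vecMulVec x (star x)) *ᵥ y =
      ((‖x‖ ^ 2 * ‖y‖ ^ 2 : ℝ) : ℂ) * q χ (‖x‖⁻¹ • x, ‖y‖⁻¹ • y) := fun χ => by
    have h := dotProduct_map_smul_smul χ ‖x‖ ‖y‖ (‖x‖⁻¹ • x) (‖y‖⁻¹ • y)
    rwa [← hxs, ← hys] at h
  rw [hscale, hscale, mul_left_comm]
  exact mul_le_mul_of_nonneg_left hle hc

theorem mem_relInt_coneP1 {φ : Maps m n} (hφ : φ ∈ coneP1 m n)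
    (hpos : ∀ (x : Fin m → ℂ) (y : Fin n → ℂ), x ≠ 0 → y ≠ 0 →
      star y ⬝ᵥ φ (Matrix.vecMulVec x (star x)) *ᵥ y ≠ 0) : φ ∈ relInt (coneP1 m n) := by
  refine mem_relInt_of_forall_exists convex_coneP1 hφ fun ψ hψ => ?_
  obtain ⟨C, hC, hle⟩ := exists_dotProduct_map_le hφ hψ hpos
  refine ⟨C⁻¹, by positivity, mem_coneP1_of_forall fun x y => ?_⟩
  have hC' : (0 : ℂ) ≤ ((C⁻¹ : ℝ) : ℂ) := by exact_mod_cast (inv_pos.2 hC).le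
  have h1 := mul_le_mul_of_nonneg_left (hle x y) hC'
  rw [← mul_assoc, ← Complex.ofReal_mul, inv_mul_cancel₀ hC.ne', Complex.ofReal_one,
    one_mul] at h1
  have h2 := mul_nonneg hC' (dotProduct_map_nonneg hφ x y)
  have : star y ⬝ᵥ (φ + C⁻¹ • (φ - ψ)) (Matrix.vecMulVec x (star x)) *ᵥ y =
      ((C⁻¹ : ℝ) : ℂ) * (star y ⬝ᵥ φ (Matrix.vecMulVec x (star x)) *ᵥ y) +
      (star y ⬝ᵥ φ (Matrix.vecMulVec x (star x)) *ᵥ y -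
        ((C⁻¹ : ℝ) : ℂ) * (star y ⬝ᵥ ψ (Matrix.vecMulVec x (star x)) *ᵥ y)) := by
    simp only [add_apply, smul_apply, sub_apply, Matrix.add_mulVec, Matrix.smul_mulVec, Matrix.sub_mulVec,
      dotProduct_add, dotProduct_smul, dotProduct_sub, Complex.real_smul]
    ring
  rw [this]
  exact add_nonneg h2 (sub_nonneg.2 h1)

end Positive

/-! ### Edge states -/

section Edge

variable {m n : ℕ}

/-- The face of an edge state contains no nonzero separable matrix, as a multiple of a product
projection could be subtracted from the edge state otherwise. -/
theorem IsEdgeState.notMem_coneV1 {A : Block m n} (hA : IsEdgeState A) {B : Block m n}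
    (hB : B ∈ bidualFace A) (hB0 : B ≠ 0) : B ∉ coneV1 m n := by
  intro hV
  obtain ⟨y, x, hy, hx, c, hc, hsub⟩ := (exists_sub_prodProj_mem_coneT hV).2 hB0
  obtain ⟨ε, hε, hmem⟩ := exists_sub_smul_mem_coneT hA.2.1 hB
  refine hA.2.2.2 y x hy hx (ε * c) (by positivity) ?_
  have := add_mem_coneT hmem (smul_mem_coneT hε.le hsub)
  convert this using 1
  module

theorem prodProj_mem_coneV1 (y : Fin n → ℂ) (x : Fin m → ℂ) : prodProj y x ∈ coneV1 m n :=
  subset_convexHull ℝ _ ⟨y, x, rfl⟩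

/-- A matrix in the dual cone that annihilates a relatively interior point of a subset annihilates
the whole subset. -/
theorem mem_dualFace_of_mem_relInt {C S : Set (Maps m n)} (hS : S ⊆ C) {B : Block m n}
    (hB : B ∈ dualCone C) {φ : Maps m n} (hφ : φ ∈ relInt S) (h0 : pairing B φ = 0) :
    B ∈ dualFace C S := by
  refine ⟨hB, fun ψ hψ => le_antisymm ?_ (hB ψ (hS hψ))⟩
  obtain ⟨δ, hδ, hmem⟩ := exists_add_smul_sub_mem_of_mem_relInt hφ hψ
  have h := hB _ (hS hmem)
  have hδ' : (0 : ℂ) < δ := by exact_mod_cast hδ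
  rw [pairing_add_right, pairing_smul_right, pairing_sub_right, h0, zero_add, zero_sub,
    mul_neg, Left.nonneg_neg_iff] at h
  exact le_of_mul_le_mul_left (by simpa using h) hδ'

theorem IsEdgeState.relInt_sigma_subset {A : Block m n} (hA : IsEdgeState A) :
    relInt (sigma (kerSubmodule A) (kerSubmodule (blockTranspose A))) ⊆
      relInt (coneP1 m n) := by
  intro φ hφ
  refine mem_relInt_coneP1 (coneD_subset_coneP1 (sigma_subset_coneD (intrinsicInterior_subset hφ)))
    fun x y hx hy h0 => ?_
  rw [← pairing_prodProj] at h0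
  have hy' : star y ≠ 0 := star_ne_zero.2 hy
  refine hA.notMem_coneV1 (mem_dualFace_of_mem_relInt sigma_subset_coneD ?_ hφ h0)
    (prodProj_ne_zero hy' hx) (prodProj_mem_coneV1 _ _)
  rw [dualCone_coneD]
  exact prodProj_mem_coneT _ _

/-- A proper face `σ(D, E)` whose relative interior lies in the relative interior of `ℙ₁` is reached
from every relatively interior point `φ₀` of `𝔻`: extend a segment from `φ₀` to a relatively
interior point of the face slightly beyond its end, which leaves `𝔻` but not `ℙ₁`. -/
theorem exists_arisesFrom {D E : Submodule ℂ (Matrix (Fin m) (Fin n) ℂ)}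
    (hface : IsFace (coneD m n) (sigma D E)) (hne : sigma D E ≠ coneD m n)
    (hint : relInt (sigma D E) ⊆ relInt (coneP1 m n)) {φ₀ : Maps m n}
    (hφ₀ : φ₀ ∈ relInt (coneD m n)) :
    ∃ φ ∈ coneP1 m n \ coneD m n, ArisesFrom (sigma D E) φ₀ φ := by
  obtain ⟨ψ, hψ⟩ := relInt_nonempty hface.2.1 hface.1
  have hψσ : ψ ∈ sigma D E := intrinsicInterior_subset hψ
  have hφ₀D : φ₀ ∈ coneD m n := intrinsicInterior_subset hφ₀
  have hφ₀σ : φ₀ ∉ sigma D E := notMem_sigma_of_mem_relInt_coneD hface hne hφ₀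
  obtain ⟨δ, hδ, hP⟩ :=
    exists_add_smul_sub_mem_of_mem_relInt (hint hψ) (coneD_subset_coneP1 hφ₀D)
  have hbeyond : ∀ s : ℝ, 0 < s → ψ + s • (ψ - φ₀) ∉ coneD m n := fun s hs hmem =>
    hφ₀σ (hface.2.2.left_mem_of_mem_openSegment hφ₀D hmem hψσ
      (mem_openSegment_add_smul_sub ψ φ₀ hs))
  have h1 : 0 < 1 + δ := by positivity
  -- The point of parameter `s` passes beyond `ψ` as soon as `s > 1 / (1 + δ)`.
  have hpt : ∀ s : ℝ, (1 - s) • φ₀ + s • (ψ + δ • (ψ - φ₀)) =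
      ψ + (s * (1 + δ) - 1) • (ψ - φ₀) := fun s => by module
  have ht : (1 - 1 / (1 + δ)) • φ₀ + (1 / (1 + δ)) • (ψ + δ • (ψ - φ₀)) = ψ := by
    rw [hpt, one_div, inv_mul_cancel₀ h1.ne', sub_self, zero_smul ℝ (ψ - φ₀), add_zero]
  have ht1 : 1 / (1 + δ) < 1 := (div_lt_one h1).2 (by linarith)
  refine ⟨ψ + δ • (ψ - φ₀), ⟨hP, hbeyond δ hδ⟩, 1 / (1 + δ), by positivity, ht1,
    ⟨⟨⟨by positivity, ht1.le⟩, ?_⟩, ?_⟩, hface, ?_⟩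
  · rw [ht]
    exact sigma_subset_coneD hψσ
  · rintro s ⟨-, hs⟩
    by_contra hlt
    rw [hpt] at hs
    refine hbeyond _ ?_ hs
    rw [not_le, div_lt_iff₀ h1] at hlt
    linarith
  · rwa [ht]

end Edge

end PPTEdge

open PPTEdge
theorem mainTheorem4 (m n : ℕ) (A : Block m n) (hA : IsEdgeState A) :
    ∃ F : Set (Block m n),
      (IsFace (coneT m n) F ∧ A ∈ relInt F ∧
        ∀ G : Set (Block m n), IsFace (coneT m n) G → A ∈ relInt G → G = F) ∧
      ∃ D E : Submodule ℂ (Matrix (Fin m) (Fin n) ℂ),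
        IsExposedDecompositionPair D E ∧
        F = dualFace (coneD m n) (sigma D E) ∧
        sigma D E ≠ coneD m n ∧
        dualFace (coneD m n) (sigma D E) \ {0} ⊆ coneT m n \ coneV1 m n ∧
        relInt (sigma D E) ⊆ relInt (coneP1 m n) ∧
        (relInt (coneD m n)).Nonempty ∧
        ∀ φ₀ ∈ relInt (coneD m n), ∃ φ ∈ coneP1 m n \ coneD m n,
          ArisesFrom (sigma D E) φ₀ φ := by
  have hT : A ∈ coneT m n := hA.2.1
  have hA0 : A ≠ 0 := by
    rintro rfl
    simpa using hA.1
  have hpair := isExposedDecompositionPair_kerSubmodule hT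
  have hne := sigma_kerSubmodule_ne_coneD hT hA0
  refine ⟨bidualFace A, ⟨isFace_bidualFace A, self_mem_relInt_bidualFace hT, fun G hG hAG =>
    (isFace_bidualFace A).eq_of_mem_relInt hG (self_mem_relInt_bidualFace hT) hAG⟩,
    kerSubmodule A, kerSubmodule (blockTranspose A), hpair, rfl, hne, ?_,
    hA.relInt_sigma_subset, ?_, fun φ₀ hφ₀ =>
      exists_arisesFrom hpair.1.1 hne hA.relInt_sigma_subset hφ₀⟩
  · rintro B ⟨hB, hB0⟩
    exact ⟨(isFace_bidualFace A).2.2.subset hB, hA.notMem_coneV1 hB hB0⟩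
  · exact relInt_nonempty (convex_convexHull ℝ _) ⟨0, sigma_subset_coneD (zero_mem_sigma (D := ⊥)
      (E := ⊥))⟩
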